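/- **Lemma 2.1.** Let $\underline\mu<\mu_0<\mu_1<\overline\mu$, $0<\underline\sigma^2\le\overline\sigma^2<\infty$ and $0<\varepsilon<\underline\sigma^2$, and put $$J=[\underline\mu,\overline\mu]\times[\underline\sigma^2,\overline\sigma^2],\qquad J_\varepsilon=(\underline\mu-\varepsilon,\overline\mu+\varepsilon)\times(\underline\sigma^2-\varepsilon,\overline\sigma^2+\varepsilon).$$ For $A_0,A_1>0$, $u\in\mathbb R$, $v^2>0$ and $i=0,1$ let $$I_i(u,v^2)=\tfrac12\log\!\left[1+\frac{(u-\mu_i)^2}{v^2}\right],\qquad n(u,v^2)=\min_{i=0,1}\frac{A_i}{I_i(u,v^2)},$$ where $A_i/I_i(\mu_i,v^2)=\infty$. Let $X_1,X_2,\dots$ be i.i.d. $N(\mu,\sigma^2)$ under $P_{\mu,\sigma^2}$, and let $\bar X_k=\frac1k\sum_{i=1}^kX_i$ and $\hat\sigma_k^2=\frac1k\sum_{i=1}^k(X_i-\bar X_k)^2$. For every $R\ge1$ there are constants $B>0$ and $C$, depending only on $\mu_0,\mu_1,\underline\mu,\overline\mu,\underline\sigma^2,\overline\sigma^2,\varepsilon,R$,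 such that, with $\rho_k=1+B\sqrt{k^{-1}\log k}$, $$P_{\mu,\sigma^2}\!\left((\bar X_k,\hat\sigma_k^2)\in J_\varepsilon\ \text{ and }\ \rho_k^{-1}<\frac{n(\bar X_k,\hat\sigma_k^2)}{n(\mu,\sigma^2)}<\rho_k\ \text{ for all }k\ge k_0\right)\ \ge\ 1-\frac{C}{k_0}$$ for all integers $k_0\ge1$, all $(\mu,\sigma^2)\in J$ and all $A_0,A_1>0$ with $R^{-1}\le A_0/A_1\le R$. -/

import Mathlib

open MeasureTheory ProbabilityTheory
open scoped ENNReal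

noncomputable section

/-- Sample mean of the first `k` observations; the observations `X₁, X₂, …` of the text are
`X 0, X 1, …`. -/
def sampleMean {Ω : Type*} (X : ℕ → Ω → ℝ) (k : ℕ) (ω : Ω) : ℝ :=
  (∑ i ∈ Finset.range k, X i ω) / k

/-- Sample variance (with divisor `k`) of the first `k` observations. -/
def sampleVar {Ω : Type*} (X : ℕ → Ω → ℝ) (k : ℕ) (ω : Ω) : ℝ :=
  (∑ i ∈ Finset.range k, (X i ω - sampleMean X k ω) ^ 2) / k

/-- The Kullback–Leibler information number `I(u, v²) = (1/2) log (1 + (u - m)² / v²)` relative to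
the mean `m`; the argument `v2` is the variance `v²`. -/
def klInfo (m u v2 : ℝ) : ℝ :=
  (1 / 2) * Real.log (1 + (u - m) ^ 2 / v2)

/-- `A / I(u, v²)`, with values in `[0, ∞]`, so that it is `∞` where the information vanishes
(see `crossingSize_self`). -/
def crossingSize (m A u v2 : ℝ) : ℝ≥0∞ :=
  ENNReal.ofReal A / ENNReal.ofReal (klInfo m u v2)

theorem crossingSize_self (m A v2 : ℝ) (hA : 0 < A) : crossingSize m A m v2 = ∞ := by
  simp [crossingSize, klInfo, ENNReal.div_zero, hA]

/-- `n(u, v²) = min (A₀ / I₀(u, v²)) (A₁ / I₁(u, v²))`. -/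
def totalSize (μ₀ μ₁ A₀ A₁ u v2 : ℝ) : ℝ≥0∞ :=
  min (crossingSize μ₀ A₀ u v2) (crossingSize μ₁ A₁ u v2)

/-- `J = [μlo, μhi] × [slo, shi]`, where `slo` and `shi` bound the variance. -/
def paramBox (μlo μhi slo shi : ℝ) : Set (ℝ × ℝ) :=
  Set.Icc μlo μhi ×ˢ Set.Icc slo shi

/-- `J_ε = (μlo - ε, μhi + ε) × (slo - ε, shi + ε)`. -/
def paramBoxExt (μlo μhi slo shi ε : ℝ) : Set (ℝ × ℝ) :=
  Set.Ioo (μlo - ε) (μhi + ε) ×ˢ Set.Ioo (slo - ε) (shi + ε)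

/-- `ρ_k = 1 + B √(k⁻¹ log k)`. -/
def rho (B : ℝ) (k : ℕ) : ℝ :=
  1 + B * Real.sqrt ((k : ℝ)⁻¹ * Real.log k)

/-- The event that for all `k ≥ k₀` the estimates lie in `J_ε` and the ratio of the estimated to the
correct total sample size lies strictly between `ρ_k⁻¹` and `ρ_k`; `s2` is the variance `σ²`. -/
def goodEvent {Ω : Type*} (X : ℕ → Ω → ℝ) (μ₀ μ₁ A₀ A₁ μlo μhi slo shi ε B μ s2 : ℝ) (k₀ : ℕ) :
    Set Ω :=
  {ω | ∀ k : ℕ, k₀ ≤ k →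
    (sampleMean X k ω, sampleVar X k ω) ∈ paramBoxExt μlo μhi slo shi ε ∧
    ENNReal.ofReal (rho B k)⁻¹ <
      totalSize μ₀ μ₁ A₀ A₁ (sampleMean X k ω) (sampleVar X k ω) /
        totalSize μ₀ μ₁ A₀ A₁ μ s2 ∧
    totalSize μ₀ μ₁ A₀ A₁ (sampleMean X k ω) (sampleVar X k ω) /
        totalSize μ₀ μ₁ A₀ A₁ μ s2 < ENNReal.ofReal (rho B k)}

end

/-! The reciprocal of n is M = max(I₀/A₀, I₁/A₁), which is finite and, since u cannot be close to
both means, at least a constant over max(A₀, A₁) when v² is bounded. Each Iᵢ is Lipschitz where v²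
is bounded below, so M has a relative Lipschitz constant in which A₀, A₁ enter only through R
(`infoMax_le_mul`). Estimates within δ of the parameters thus give a ratio within a factor 1 + O(δ)
of 1.

It remains to take δ of order s = √(log k / k). For standard normal Z, both Z and Z² − 1 have moment
generating functions at most exp(2t²) near 0, so a Chernoff bound gives failure probability at most
4/k² at sample size k (`measureReal_standard_deviation_le`). Summing over k ≥ k₀ gives 8/k₀. For
small k₀ the constant C makes the claim vacuous. -/

/-! ### Moment generating functions of Z and Z² − 1 -/

lemma one_le_one_sub_mul_exp {y : ℝ} (hy : |y| ≤ 1 / 4) : 1 ≤ (1 - y) * Real.exp (y + y ^ 2) := by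
  obtain ⟨h1, h2⟩ := abs_le.1 hy
  have hz : 0 ≤ 1 + (y + y ^ 2) / 2 := by nlinarith [sq_nonneg y]
  have hexp : (1 + (y + y ^ 2) / 2) ^ 2 ≤ Real.exp (y + y ^ 2) := by
    have h := Real.add_one_le_exp ((y + y ^ 2) / 2)
    calc (1 + (y + y ^ 2) / 2) ^ 2 ≤ Real.exp ((y + y ^ 2) / 2) ^ 2 := by
          gcongr; linarith
      _ = Real.exp (y + y ^ 2) := by rw [← Real.exp_nat_mul]; congr 1; push_cast; ring
  have hpoly : 1 ≤ (1 - y) * (1 + (y + y ^ 2) / 2) ^ 2 := by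
    -- The product in `hpoly` exceeds 1 by exactly y²/4 times this polynomial.
    have hq : 0 ≤ 1 - 3 * y - y ^ 2 - y ^ 3 := by nlinarith [sq_nonneg y]
    nlinarith [mul_nonneg (sq_nonneg y) hq]
  exact hpoly.trans (mul_le_mul_of_nonneg_left hexp (by linarith))

/-- The moment generating function of a centred chi-square variable with one degree of freedom. -/
lemma mgf_sq_sub_one_gaussianReal {t : ℝ} :
    mgf (fun x : ℝ => x ^ 2 - 1) (gaussianReal 0 1) t =
      Real.exp (-t) * ((√(2 * Real.pi))⁻¹ * √(Real.pi / (1 / 2 - t))) := by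
  rw [mgf, integral_gaussianReal_eq_integral_smul one_ne_zero, ← integral_gaussian,
    ← integral_const_mul, ← integral_const_mul]
  congr 1
  funext x
  simp only [gaussianPDFReal, NNReal.coe_one, mul_one, sub_zero, smul_eq_mul]
  rw [show t * (x ^ 2 - 1) = -t + t * x ^ 2 by ring,
    show -(1 / 2 - t) * x ^ 2 = -x ^ 2 / 2 + t * x ^ 2 by ring, Real.exp_add, Real.exp_add]
  ring

/-- The function is e^(-t) (1 - 2t)^(-1/2), bounded by `one_le_one_sub_mul_exp` with y = 2t.
Positivity is recorded because it encodes integrability: `mgf` is 0 when the integral diverges. -/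
lemma mgf_sq_sub_one_gaussianReal_bounds {t : ℝ} (ht : |t| ≤ 1 / 8) :
    0 < mgf (fun x : ℝ => x ^ 2 - 1) (gaussianReal 0 1) t ∧
      mgf (fun x : ℝ => x ^ 2 - 1) (gaussianReal 0 1) t ≤ Real.exp (2 * t ^ 2) := by
  obtain ⟨h1, h2⟩ := abs_le.1 ht
  have hpi := Real.pi_pos
  have hpos : 0 < 1 / 2 - t := by linarith
  rw [mgf_sq_sub_one_gaussianReal]
  refine ⟨by positivity, ?_⟩
  have hy : |2 * t| ≤ 1 / 4 := by rw [abs_le]; constructor <;> linarith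
  have hkey := one_le_one_sub_mul_exp hy
  have hsqrt : (√(2 * Real.pi))⁻¹ * √(Real.pi / (1 / 2 - t)) ≤ Real.exp (t + 2 * t ^ 2) := by
    rw [← Real.sqrt_inv, ← Real.sqrt_mul (by positivity)]
    refine Real.sqrt_le_iff.2 ⟨(Real.exp_pos _).le, ?_⟩
    rw [← Real.exp_nat_mul,
      show (2 * Real.pi)⁻¹ * (Real.pi / (1 / 2 - t)) = 1 / (1 - 2 * t) by
        have : 1 - 2 * t ≠ 0 := by linarith
        have : 1 / 2 - t ≠ 0 := hpos.ne'
        field_simp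
        ,
      div_le_iff₀ (by linarith),
      show ((2 : ℕ) : ℝ) * (t + 2 * t ^ 2) = 2 * t + (2 * t) ^ 2 by push_cast; ring]
    linarith
  calc Real.exp (-t) * ((√(2 * Real.pi))⁻¹ * √(Real.pi / (1 / 2 - t)))
      ≤ Real.exp (-t) * Real.exp (t + 2 * t ^ 2) := by gcongr
    _ = Real.exp (2 * t ^ 2) := by rw [← Real.exp_add]; congr 1; ring

lemma mgf_id_gaussianReal_bounds (t : ℝ) :
    0 < mgf (fun x : ℝ => x) (gaussianReal 0 1) t ∧
      mgf (fun x : ℝ => x) (gaussianReal 0 1) t ≤ Real.exp (2 * t ^ 2) := by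
  rw [mgf_fun_id_gaussianReal]
  refine ⟨Real.exp_pos _, Real.exp_le_exp.2 ?_⟩
  simp only [NNReal.coe_one]
  nlinarith [sq_nonneg t]

/-! ### Chernoff bounds and the union over sample sizes -/

section Concentration

variable {Ω : Type*} [MeasurableSpace Ω] {P : Measure Ω}

/-- Two-sided Bernstein-type tail bound for sums of independent variables whose moment generating
functions are at most `exp (2 t²)` near the origin. -/
lemma measureReal_abs_sum_ge_le [IsProbabilityMeasure P] {Y : ℕ → Ω → ℝ} (hind : iIndepFun Y P)
    (hm : ∀ i, AEMeasurable (Y i) P)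
    (hmgf : ∀ i t, |t| ≤ 1 / 8 → 0 < mgf (Y i) P t ∧ mgf (Y i) P t ≤ Real.exp (2 * t ^ 2))
    (k : ℕ) {x : ℝ} (hx0 : 0 ≤ x) (hx1 : x ≤ 1 / 2) :
    P.real {ω | k * x ≤ |∑ i ∈ Finset.range k, Y i ω|} ≤ 2 * Real.exp (-(k * x ^ 2 / 8)) := by
  set S : Ω → ℝ := ∑ i ∈ Finset.range k, Y i with hS
  have hsum (t : ℝ) (ht : |t| ≤ 1 / 8) :
      Integrable (fun ω => Real.exp (t * S ω)) P ∧ mgf S P t ≤ Real.exp (k * (2 * t ^ 2)) := by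
    have h := hind.mgf_sum₀ (t := t) hm (Finset.range k)
    constructor
    · rw [← mgf_pos_iff, h]
      exact Finset.prod_pos fun i _ => (hmgf i t ht).1
    · rw [h, Real.exp_nat_mul]
      calc ∏ i ∈ Finset.range k, mgf (Y i) P t
          ≤ ∏ _i ∈ Finset.range k, Real.exp (2 * t ^ 2) :=
            Finset.prod_le_prod (fun i _ => (hmgf i t ht).1.le) fun i _ => (hmgf i t ht).2
        _ = _ := by simp
  -- t = x/4 minimizes -tx + 2t², with value -x²/8; x ≤ 1/2 keeps it in the admissible range.
  have hx4 : |x / 4| ≤ 1 / 8 := by rw [abs_le]; constructor <;> linarith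
  have hx4' : |-(x / 4)| ≤ 1 / 8 := by rwa [abs_neg]
  have hup : P.real {ω | k * x ≤ S ω} ≤ Real.exp (-(k * x ^ 2 / 8)) := by
    obtain ⟨hi, hb⟩ := hsum _ hx4
    calc _ ≤ Real.exp (-(x / 4) * (k * x)) * mgf S P (x / 4) :=
          measure_ge_le_exp_mul_mgf _ (by positivity) hi
      _ ≤ Real.exp (-(x / 4) * (k * x)) * Real.exp (k * (2 * (x / 4) ^ 2)) := by gcongr
      _ = _ := by rw [← Real.exp_add]; congr 1; ring
  have hdown : P.real {ω | S ω ≤ -(k * x)} ≤ Real.exp (-(k * x ^ 2 / 8)) := by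
    obtain ⟨hi, hb⟩ := hsum _ hx4'
    calc _ ≤ Real.exp (-(-(x / 4)) * -(k * x)) * mgf S P (-(x / 4)) :=
          measure_le_le_exp_mul_mgf _ (by linarith) hi
      _ ≤ Real.exp (-(-(x / 4)) * -(k * x)) * Real.exp (k * (2 * (-(x / 4)) ^ 2)) := by gcongr
      _ = _ := by rw [← Real.exp_add]; congr 1; ring
  have hsub : {ω | k * x ≤ |∑ i ∈ Finset.range k, Y i ω|} ⊆
      {ω | k * x ≤ S ω} ∪ {ω | S ω ≤ -(k * x)} := by
    intro ω hω
    simp only [Set.mem_ofPred_eq, Set.mem_union, hS, Finset.sum_apply] at hω ⊢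
    rcases le_abs'.1 hω with h | h
    · exact Or.inr h
    · exact Or.inl h
  calc _ ≤ P.real ({ω | k * x ≤ S ω} ∪ {ω | S ω ≤ -(k * x)}) := measureReal_mono hsub
    _ ≤ _ := measureReal_union_le _ _
    _ ≤ _ := by linarith

/-- The union bound telescopes, because 1/m² ≤ 2/m - 2/(m+1) for m ≥ 1. -/
lemma measureReal_iUnion_le_of_inv_sq [IsFiniteMeasure P] {E : ℕ → Set Ω} {k₀ : ℕ} (hk₀ : 1 ≤ k₀)
    {c : ℝ} (hc : 0 ≤ c) (hE : ∀ k, k₀ ≤ k → P.real (E k) ≤ c / (k : ℝ) ^ 2) :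
    P.real (⋃ j, E (k₀ + j)) ≤ 2 * c / k₀ := by
  have hk : (1 : ℝ) ≤ k₀ := by exact_mod_cast hk₀
  have hpart (n : ℕ) :
      ∑ j ∈ Finset.range n, P.real (E (k₀ + j)) ≤ 2 * c / k₀ - 2 * c / (k₀ + n) := by
    induction n with
    | zero => simp
    | succ n ih =>
      rw [Finset.sum_range_succ]
      have h := hE (k₀ + n) (by omega)
      push_cast at h ⊢
      have hn : (0 : ℝ) ≤ n := Nat.cast_nonneg n
      set m : ℝ := (k₀ : ℝ) + n with hm
      have hm1 : 1 ≤ m := by linarith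
      have hstep : c / m ^ 2 ≤ 2 * c / m - 2 * c / (m + 1) := by
        rw [show 2 * c / m - 2 * c / (m + 1) = 2 * c / (m * (m + 1)) by
          field_simp; ring]
        rw [div_le_div_iff₀ (by positivity) (by positivity)]
        nlinarith [mul_nonneg hc (mul_nonneg (by linarith : 0 ≤ m) (by linarith : 0 ≤ m - 1))]
      rw [show (k₀ : ℝ) + (n + 1) = m + 1 by rw [hm]; ring]
      linarith
  refine ENNReal.toReal_le_of_le_ofReal (by positivity) ?_
  refine (measure_iUnion_le _).trans (ENNReal.tsum_le_of_sum_range_le fun n => ?_)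
  calc ∑ j ∈ Finset.range n, P (E (k₀ + j))
      = ENNReal.ofReal (∑ j ∈ Finset.range n, P.real (E (k₀ + j))) := by
        rw [ENNReal.ofReal_sum_of_nonneg fun _ _ => measureReal_nonneg]
        simp
    _ ≤ _ := ENNReal.ofReal_le_ofReal <| (hpart n).trans <| by
        have : 0 ≤ 2 * c / ((k₀ : ℝ) + n) := by positivity
        linarith

/-- With `s = √(log k / k)`, the standardized sample mean and mean square of `k` standard Gaussian
variables both lie within `4 s` of their expectations, up to probability `4 / k²`. -/
lemma measureReal_standard_deviation_le [IsProbabilityMeasure P] {Z : ℕ → Ω → ℝ}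
    (hZ : ∀ i, HasLaw (Z i) (gaussianReal 0 1) P) (hind : iIndepFun Z P) {k : ℕ} (hk : 2 ≤ k)
    {s : ℝ} (hs : s = √((k : ℝ)⁻¹ * Real.log k)) (hs1 : s ≤ 1 / 8) :
    P.real ({ω | k * (4 * s) ≤ |∑ i ∈ Finset.range k, Z i ω|} ∪
      {ω | k * (4 * s) ≤ |∑ i ∈ Finset.range k, (Z i ω ^ 2 - 1)|}) ≤ 4 / (k : ℝ) ^ 2 := by
  have hk' : (2 : ℝ) ≤ k := by exact_mod_cast hk
  have hlog : 0 ≤ Real.log k := Real.log_nonneg (by linarith)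
  have hs0 : 0 ≤ s := hs ▸ Real.sqrt_nonneg _
  -- The factor 4 turns the Chernoff exponent into 2 log k.
  have hval : Real.exp (-(k * (4 * s) ^ 2 / 8)) = 1 / (k : ℝ) ^ 2 := by
    rw [mul_pow, hs, Real.sq_sqrt (by positivity),
      show -((k : ℝ) * (4 ^ 2 * ((k : ℝ)⁻¹ * Real.log k)) / 8) = -((2 : ℕ) * Real.log k) by
        field_simp; push_cast; ring,
      Real.exp_neg, Real.exp_nat_mul, Real.exp_log (by linarith), one_div]
  have h1 := measureReal_abs_sum_ge_le hind (fun i => (hZ i).aemeasurable)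
    (fun i t _ => by
      have := mgf_id_gaussianReal_bounds t
      rwa [← (hZ i).map_eq, mgf_map (hZ i).aemeasurable (by fun_prop)] at this)
    k (by positivity : 0 ≤ 4 * s) (by linarith)
  have h2 := measureReal_abs_sum_ge_le (Y := fun i ω => Z i ω ^ 2 - 1)
    (hind.comp (fun _ x => x ^ 2 - 1) fun _ => by fun_prop)
    (fun i => ((hZ i).aemeasurable.pow_const 2).sub_const 1)
    (fun i t ht => by
      have := mgf_sq_sub_one_gaussianReal_bounds ht
      rwa [← (hZ i).map_eq, mgf_map (hZ i).aemeasurable (by fun_prop)] at this)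
    k (by positivity : 0 ≤ 4 * s) (by linarith)
  rw [hval] at h1 h2
  refine (measureReal_union_le _ _).trans ((add_le_add h1 h2).trans_eq (by ring))

end Concentration

/-! ### Lipschitz estimates for the information numbers -/

section Deterministic

/-- `max (I₀ / A₀) (I₁ / A₁)`, the reciprocal of `totalSize`. -/
noncomputable def infoMax (μ₀ μ₁ A₀ A₁ u v : ℝ) : ℝ :=
  max (klInfo μ₀ u v / A₀) (klInfo μ₁ u v / A₁)

lemma crossingSize_eq_inv {m A u v : ℝ} (hA : 0 < A) :
    crossingSize m A u v = (ENNReal.ofReal (klInfo m u v / A))⁻¹ := by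
  rw [crossingSize, ENNReal.ofReal_div_of_pos hA, ENNReal.inv_div]
  · exact Or.inl ENNReal.ofReal_ne_top
  · exact Or.inl (ENNReal.ofReal_pos.2 hA).ne'

lemma totalSize_eq_inv {μ₀ μ₁ A₀ A₁ u v : ℝ} (hA₀ : 0 < A₀) (hA₁ : 0 < A₁) :
    totalSize μ₀ μ₁ A₀ A₁ u v = (ENNReal.ofReal (infoMax μ₀ μ₁ A₀ A₁ u v))⁻¹ := by
  rw [totalSize, crossingSize_eq_inv hA₀, crossingSize_eq_inv hA₁, infoMax]
  have h := ENNReal.ofReal_mono.map_max (a := klInfo μ₀ u v / A₀) (b := klInfo μ₁ u v / A₁)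
  rw [h]
  exact ((ENNReal.inv_strictAnti.antitone).map_max).symm

lemma totalSize_div_totalSize {μ₀ μ₁ A₀ A₁ u v u' v' : ℝ} (hA₀ : 0 < A₀) (hA₁ : 0 < A₁)
    (h : 0 < infoMax μ₀ μ₁ A₀ A₁ u v) :
    totalSize μ₀ μ₁ A₀ A₁ u v / totalSize μ₀ μ₁ A₀ A₁ u' v' =
      ENNReal.ofReal (infoMax μ₀ μ₁ A₀ A₁ u' v' / infoMax μ₀ μ₁ A₀ A₁ u v) := by
  rw [totalSize_eq_inv hA₀ hA₁, totalSize_eq_inv hA₀ hA₁, ENNReal.ofReal_div_of_pos h,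
    div_eq_mul_inv, inv_inv, div_eq_mul_inv, mul_comm]

lemma log_le_log_add_abs_sub_div {a x y : ℝ} (ha : 0 < a) (hx : 0 < x) (hy : a ≤ y) :
    Real.log x ≤ Real.log y + |x - y| / a := by
  have hy0 : 0 < y := ha.trans_le hy
  have h := Real.log_le_sub_one_of_pos (div_pos hx hy0)
  rw [Real.log_div hx.ne' hy0.ne'] at h
  have h2 : x / y - 1 ≤ |x - y| / a := by
    rw [div_sub_one hy0.ne']
    exact div_le_div₀ (abs_nonneg _) (le_abs_self _) ha hy
  linarith

/-- Twice the information is log(v + (u - m)²) - log v, and the logarithm is 1/a-Lipschitz on [a,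
∞). -/
lemma klInfo_le_add {m u v u' v' a D δ : ℝ} (ha : 0 < a) (hv : a ≤ v) (hv' : a ≤ v')
    (hu : |u - m| ≤ D) (hu' : |u' - m| ≤ D) (hdu : |u - u'| ≤ δ) (hdv : |v - v'| ≤ δ) :
    klInfo m u v ≤ klInfo m u' v' + (1 + D) / a * δ := by
  have hv0 := ha.trans_le hv
  have hv0' := ha.trans_le hv'
  have hexpand {w z : ℝ} (hz : 0 < z) :
      Real.log (1 + (w - m) ^ 2 / z) = Real.log (z + (w - m) ^ 2) - Real.log z := by
    rw [← Real.log_div (by positivity) hz.ne']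
    congr 1
    field_simp
  have h1 : Real.log (v + (u - m) ^ 2) ≤
      Real.log (v' + (u' - m) ^ 2) + |v + (u - m) ^ 2 - (v' + (u' - m) ^ 2)| / a :=
    log_le_log_add_abs_sub_div ha (by positivity) (by nlinarith [sq_nonneg (u' - m)])
  have h2 := log_le_log_add_abs_sub_div ha hv0' hv
  have h3 : |v + (u - m) ^ 2 - (v' + (u' - m) ^ 2)| ≤ δ + δ * (2 * D) := by
    calc |v + (u - m) ^ 2 - (v' + (u' - m) ^ 2)|
        = |(v - v') + (u - u') * ((u - m) + (u' - m))| := by congr 1; ring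
      _ ≤ |v - v'| + |u - u'| * |(u - m) + (u' - m)| := by
          rw [← abs_mul]; exact abs_add_le _ _
      _ ≤ δ + δ * (2 * D) := by
          have h4 : |(u - m) + (u' - m)| ≤ 2 * D := (abs_add_le _ _).trans (by linarith)
          have hδ : 0 ≤ δ := (abs_nonneg _).trans hdu
          gcongr
  have h3' : |v + (u - m) ^ 2 - (v' + (u' - m) ^ 2)| / a ≤ (δ + δ * (2 * D)) / a := by gcongr
  have h2' : |v' - v| / a ≤ δ / a := by rw [abs_sub_comm]; gcongr
  rw [klInfo, klInfo, hexpand hv0, hexpand hv0']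
  have e : (1 + D) / a * δ = 1 / 2 * ((δ + δ * (2 * D)) / a + δ / a) := by ring
  rw [e]
  linarith

lemma klInfo_nonneg {m u v : ℝ} (hv : 0 ≤ v) : 0 ≤ klInfo m u v := by
  have : 0 ≤ (u - m) ^ 2 / v := by positivity
  exact mul_nonneg (by norm_num) (Real.log_nonneg (by linarith))

lemma le_klInfo {m u v d b : ℝ} (hd : 0 ≤ d) (hu : d ≤ |u - m|) (hv : 0 < v) (hvb : v ≤ b) :
    1 / 2 * Real.log (1 + d ^ 2 / b) ≤ klInfo m u v := by
  have hb := hv.trans_le hvb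
  have h : d ^ 2 ≤ (u - m) ^ 2 := by rw [← sq_abs (u - m)]; gcongr
  unfold klInfo
  gcongr

/-- Any u is at least half the gap μ₁ - μ₀ away from one of the two means. -/
lemma le_infoMax {μ₀ μ₁ A₀ A₁ u v b : ℝ} (hA₀ : 0 < A₀) (hA₁ : 0 < A₁) (h01 : μ₀ < μ₁)
    (hv : 0 < v) (hvb : v ≤ b) :
    1 / 2 * Real.log (1 + ((μ₁ - μ₀) / 2) ^ 2 / b) / max A₀ A₁ ≤ infoMax μ₀ μ₁ A₀ A₁ u v := by
  have hd : 0 ≤ (μ₁ - μ₀) / 2 := by linarith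
  rcases le_total ((μ₀ + μ₁) / 2) u with hu | hu
  · refine le_trans ?_ (le_max_left _ _)
    have hu' : (μ₁ - μ₀) / 2 ≤ |u - μ₀| := le_trans (by linarith) (le_abs_self _)
    exact div_le_div₀ (klInfo_nonneg hv.le) (le_klInfo hd hu' hv hvb) hA₀ (le_max_left _ _)
  · refine le_trans ?_ (le_max_right _ _)
    have hu' : (μ₁ - μ₀) / 2 ≤ |u - μ₁| := le_trans (by linarith) (neg_le_abs _)
    exact div_le_div₀ (klInfo_nonneg hv.le) (le_klInfo hd hu' hv hvb) hA₁ (le_max_right _ _)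

lemma infoMax_le_add {μ₀ μ₁ A₀ A₁ u v u' v' L : ℝ} (hA₀ : 0 < A₀) (hA₁ : 0 < A₁) (hL : 0 ≤ L)
    (h0 : klInfo μ₀ u v ≤ klInfo μ₀ u' v' + L) (h1 : klInfo μ₁ u v ≤ klInfo μ₁ u' v' + L) :
    infoMax μ₀ μ₁ A₀ A₁ u v ≤ infoMax μ₀ μ₁ A₀ A₁ u' v' + L / min A₀ A₁ := by
  have hmin : 0 < min A₀ A₁ := lt_min hA₀ hA₁
  refine max_le ?_ ?_
  · calc klInfo μ₀ u v / A₀ ≤ (klInfo μ₀ u' v' + L) / A₀ := by gcongr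
      _ = klInfo μ₀ u' v' / A₀ + L / A₀ := add_div _ _ _
      _ ≤ _ := add_le_add (le_max_left _ _) (by gcongr; exact min_le_left _ _)
  · calc klInfo μ₁ u v / A₁ ≤ (klInfo μ₁ u' v' + L) / A₁ := by gcongr
      _ = klInfo μ₁ u' v' / A₁ + L / A₁ := add_div _ _ _
      _ ≤ _ := add_le_add (le_max_right _ _) (by gcongr; exact min_le_right _ _)

lemma max_le_mul_min {A₀ A₁ R : ℝ} (h0 : A₀ ≤ R * A₁) (h1 : A₁ ≤ R * A₀) : max A₀ A₁ ≤ R * min A₀ A₁ := by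
  rcases le_total A₀ A₁ with h | h
  · rwa [max_eq_right h, min_eq_left h]
  · rwa [max_eq_left h, min_eq_right h]

/-- `infoMax` is relatively Lipschitz on the region `|u - μᵢ| ≤ D`, `a ≤ v ≤ b`. -/
lemma infoMax_le_mul {μ₀ μ₁ A₀ A₁ u v u' v' a b D R δ c : ℝ} (hA₀ : 0 < A₀) (hA₁ : 0 < A₁)
    (hR : 1 ≤ R) (hR0 : A₀ ≤ R * A₁) (hR1 : A₁ ≤ R * A₀) (h01 : μ₀ < μ₁)
    (ha : 0 < a) (hv : a ≤ v) (hv' : a ≤ v') (hvb : v' ≤ b)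
    (hu0 : |u - μ₀| ≤ D) (hu0' : |u' - μ₀| ≤ D) (hu1 : |u - μ₁| ≤ D) (hu1' : |u' - μ₁| ≤ D)
    (hdu : |u - u'| ≤ δ) (hdv : |v - v'| ≤ δ)
    (hc : c = 1 / 2 * Real.log (1 + ((μ₁ - μ₀) / 2) ^ 2 / b)) (hc0 : 0 < c) :
    infoMax μ₀ μ₁ A₀ A₁ u v ≤
      infoMax μ₀ μ₁ A₀ A₁ u' v' * (1 + (1 + D) / a * R / c * δ) := by
  have hδ : 0 ≤ δ := (abs_nonneg _).trans hdu
  have hD : 0 ≤ D := (abs_nonneg _).trans hu0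
  have hmin : 0 < min A₀ A₁ := lt_min hA₀ hA₁
  have hmax : 0 < max A₀ A₁ := hA₀.trans_le (le_max_left _ _)
  have hRpos : 0 < R := by linarith
  have hM : c / max A₀ A₁ ≤ infoMax μ₀ μ₁ A₀ A₁ u' v' :=
    hc ▸ le_infoMax hA₀ hA₁ h01 (ha.trans_le hv') hvb
  have hL : 0 ≤ (1 + D) / a * δ := by positivity
  refine (infoMax_le_add hA₀ hA₁ hL (klInfo_le_add ha hv hv' hu0 hu0' hdu hdv)
    (klInfo_le_add ha hv hv' hu1 hu1' hdu hdv)).trans ?_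
  rw [mul_one_add]
  gcongr
  have hmm := max_le_mul_min hR0 hR1
  -- Replacing the minimum by the maximum costs a factor R; the lower bound `hM` then makes the
  -- additive error relative.
  calc (1 + D) / a * δ / min A₀ A₁ = ((1 + D) / a * δ) * (R / (R * min A₀ A₁)) := by
        field_simp
    _ ≤ ((1 + D) / a * δ) * (R / max A₀ A₁) := by gcongr
    _ = c / max A₀ A₁ * ((1 + D) / a * R / c * δ) := by field_simp
    _ ≤ _ := by gcongr

end Deterministic

/-! ### Sample moments in terms of standardized sums -/

section SampleMoments

variable {Ω : Type*} {X : ℕ → Ω → ℝ} {μ σ : ℝ} {k : ℕ} {ω : Ω}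

lemma sampleMean_sub_eq (hσ : σ ≠ 0) (hk : k ≠ 0) :
    sampleMean X k ω - μ = σ * ((∑ i ∈ Finset.range k, (X i ω - μ) / σ) / k) := by
  have hk' : (k : ℝ) ≠ 0 := by exact_mod_cast hk
  rw [← Finset.sum_div, Finset.sum_sub_distrib, sampleMean]
  simp only [Finset.sum_const, Finset.card_range, nsmul_eq_mul]
  field_simp

/-- Recentring the sum of squares from the sample mean to μ costs k times the squared error of the
mean. -/
lemma sampleVar_sub_eq (hσ : σ ≠ 0) (hk : k ≠ 0) :
    sampleVar X k ω - σ ^ 2 =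
      σ ^ 2 * ((∑ i ∈ Finset.range k, (((X i ω - μ) / σ) ^ 2 - 1)) / k) -
        (sampleMean X k ω - μ) ^ 2 := by
  have hk' : (k : ℝ) ≠ 0 := by exact_mod_cast hk
  have hsum : ∑ i ∈ Finset.range k, (X i ω - μ) = k * (sampleMean X k ω - μ) := by
    rw [Finset.sum_sub_distrib, sampleMean]
    simp only [Finset.sum_const, Finset.card_range, nsmul_eq_mul]
    field_simp
  set M := sampleMean X k ω with hM
  have h1 : ∑ i ∈ Finset.range k, (X i ω - M) ^ 2 =
      ∑ i ∈ Finset.range k, (X i ω - μ) ^ 2 - k * (M - μ) ^ 2 := by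
    have : ∀ i ∈ Finset.range k, (X i ω - M) ^ 2 =
        (X i ω - μ) ^ 2 - 2 * (M - μ) * (X i ω - μ) + (M - μ) ^ 2 := fun i _ => by ring
    rw [Finset.sum_congr rfl this, Finset.sum_add_distrib, Finset.sum_sub_distrib,
      ← Finset.mul_sum, hsum]
    simp only [Finset.sum_const, Finset.card_range, nsmul_eq_mul]
    ring
  rw [sampleVar, ← hM, h1, Finset.sum_sub_distrib]
  simp only [div_pow, ← Finset.sum_div, Finset.sum_const, Finset.card_range, nsmul_eq_mul, mul_one]
  field_simp
  ring

/-- If the standardized sums are small, then the sample mean and variance are close to `μ` and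
`σ²`. -/
lemma sampleMean_sampleVar_close {s b : ℝ} (hσ : 0 < σ) (hb : σ ^ 2 ≤ b) (hk : k ≠ 0)
    (hs0 : 0 ≤ s) (hs : s ≤ 1 / 8)
    (h1 : |∑ i ∈ Finset.range k, (X i ω - μ) / σ| ≤ k * (4 * s))
    (h2 : |∑ i ∈ Finset.range k, (((X i ω - μ) / σ) ^ 2 - 1)| ≤ k * (4 * s)) :
    |sampleMean X k ω - μ| ≤ 8 * (1 + b) * s ∧ |sampleVar X k ω - σ ^ 2| ≤ 8 * (1 + b) * s := by
  have hk' : (0 : ℝ) < k := by exact_mod_cast Nat.pos_of_ne_zero hk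
  have hdiv {S : ℝ} (h : |S| ≤ k * (4 * s)) : |S / k| ≤ 4 * s := by
    rw [abs_div, abs_of_pos hk', div_le_iff₀ hk']; linarith
  replace h1 := hdiv h1
  replace h2 := hdiv h2
  have hb0 : 0 ≤ b := (sq_nonneg σ).trans hb
  have hσ1 : σ ≤ 1 + b := by nlinarith [sq_nonneg (σ - 1)]
  have hm : |sampleMean X k ω - μ| ≤ σ * (4 * s) := by
    rw [sampleMean_sub_eq hσ.ne' hk, abs_mul, abs_of_pos hσ]
    gcongr
  constructor
  · nlinarith [mul_le_mul_of_nonneg_right hσ1 hs0]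
  · rw [sampleVar_sub_eq (μ := μ) hσ.ne' hk]
    calc _ ≤ |σ ^ 2 * ((∑ i ∈ Finset.range k, (((X i ω - μ) / σ) ^ 2 - 1)) / k)| +
          |(sampleMean X k ω - μ) ^ 2| := abs_sub _ _
      _ ≤ σ ^ 2 * (4 * s) + (σ * (4 * s)) ^ 2 := by
          rw [abs_mul, abs_of_pos (by positivity : 0 < σ ^ 2), abs_pow]
          gcongr
      _ = σ ^ 2 * (4 * s * (1 + 4 * s)) := by ring
      _ ≤ b * (4 * s * (1 + 1)) := by gcongr; linarith
      _ ≤ _ := by nlinarith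

end SampleMoments

/-! ### Standardization and assembly -/

lemma hasLaw_standardize {Ω : Type*} [MeasurableSpace Ω] {P : Measure Ω} {X : Ω → ℝ} {μ s2 : ℝ}
    (hs2 : 0 < s2) (hX : HasLaw X (gaussianReal μ s2.toNNReal) P) :
    HasLaw (fun ω => (X ω - μ) / √s2) (gaussianReal 0 1) P := by
  have h := gaussianReal_div_const (gaussianReal_sub_const hX μ) (√s2)
  have hv : s2.toNNReal / .mk (√s2 ^ 2) (sq_nonneg _) = 1 := by
    ext
    simp only [NNReal.coe_div, Real.coe_toNNReal _ hs2.le, NNReal.coe_mk, Real.sq_sqrt hs2.le,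
      NNReal.coe_one]
    exact div_self hs2.ne'
  rwa [sub_self, zero_div, hv] at h

lemma eventually_sqrt_inv_mul_log_lt {η : ℝ} (hη : 0 < η) :
    ∃ K : ℕ, ∀ k : ℕ, K ≤ k → √((k : ℝ)⁻¹ * Real.log k) < η := by
  have h : Filter.Tendsto (fun k : ℕ => √((k : ℝ)⁻¹ * Real.log k)) Filter.atTop (nhds 0) := by
    have h1 := (Real.isLittleO_log_id_atTop.tendsto_div_nhds_zero).comp
      (tendsto_natCast_atTop_atTop (R := ℝ))
    have h2 := h1.sqrt
    simpa [Function.comp_def, div_eq_inv_mul] using h2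
  exact Filter.eventually_atTop.1 (h.eventually (gt_mem_nhds hη))

/-- The conditions defining `goodEvent` at a single sample size hold as soon as both estimates are
within `δ < ε` of the parameters, for `δ` small compared with `B s`. -/
lemma ratio_bounds_of_close {μ₀ μ₁ A₀ A₁ μlo μhi slo shi ε R B c μ s2 u v s δ : ℝ}
    (hlo : μlo < μ₀) (h01 : μ₀ < μ₁) (hhi : μ₁ < μhi)
    (hε : 0 < ε) (hεs : ε < slo) (hR : 1 ≤ R)
    (hA₀ : 0 < A₀) (hA₁ : 0 < A₁) (hR0 : A₀ ≤ R * A₁) (hR1 : A₁ ≤ R * A₀)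
    (hmem : (μ, s2) ∈ paramBox μlo μhi slo shi)
    (hc : c = 1 / 2 * Real.log (1 + ((μ₁ - μ₀) / 2) ^ 2 / (shi + ε))) (hc0 : 0 < c)
    (hB : (1 + (μhi - μlo + ε)) / (slo - ε) * R / c * δ < B * s)
    (hδ : δ < ε) (hu : |u - μ| ≤ δ) (hv : |v - s2| ≤ δ) :
    (u, v) ∈ paramBoxExt μlo μhi slo shi ε ∧
    ENNReal.ofReal (1 + B * s)⁻¹ <
      totalSize μ₀ μ₁ A₀ A₁ u v / totalSize μ₀ μ₁ A₀ A₁ μ s2 ∧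
    totalSize μ₀ μ₁ A₀ A₁ u v / totalSize μ₀ μ₁ A₀ A₁ μ s2 < ENNReal.ofReal (1 + B * s) := by
  obtain ⟨⟨hm1, hm2⟩, hs1, hs2⟩ := hmem
  simp only at hm1 hm2 hs1 hs2
  obtain ⟨hu1, hu2⟩ := abs_le.1 hu
  obtain ⟨hv1, hv2⟩ := abs_le.1 hv
  have hδ0 : 0 ≤ δ := (abs_nonneg _).trans hu
  set a := slo - ε with ha_def
  set D := μhi - μlo + ε with hD_def
  have ha : 0 < a := by linarith
  have hD {w m : ℝ} (hw1 : μlo - ε ≤ w) (hw2 : w ≤ μhi + ε) (hm1 : μlo ≤ m) (hm2 : m ≤ μhi) :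
      |w - m| ≤ D := abs_le.2 ⟨by linarith, by linarith⟩
  have hD0 : 0 ≤ D := by linarith
  have hBs : 0 < B * s := lt_of_le_of_lt (by positivity) hB
  have hu0D : |u - μ₀| ≤ D := hD (by linarith) (by linarith) (by linarith) (by linarith)
  have hu1D : |u - μ₁| ≤ D := hD (by linarith) (by linarith) (by linarith) (by linarith)
  have hm0D : |μ - μ₀| ≤ D := hD (by linarith) (by linarith) (by linarith) (by linarith)
  have hm1D : |μ - μ₁| ≤ D := hD (by linarith) (by linarith) (by linarith) (by linarith)
  have hMhat := infoMax_le_mul hA₀ hA₁ hR hR0 hR1 h01 ha (by linarith : a ≤ v)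
    (by linarith : a ≤ s2) (by linarith : s2 ≤ shi + ε) hu0D hm0D hu1D hm1D hu hv hc hc0
  have hM := infoMax_le_mul hA₀ hA₁ hR hR0 hR1 h01 ha (by linarith : a ≤ s2)
    (by linarith : a ≤ v) (by linarith : v ≤ shi + ε) hm0D hu0D hm1D hu1D
    (by rwa [abs_sub_comm] : |μ - u| ≤ δ) (by rwa [abs_sub_comm]) hc hc0
  have hmax : 0 < max A₀ A₁ := hA₀.trans_le (le_max_left _ _)
  have hpos {w z : ℝ} (hz : 0 < z) (hzb : z ≤ shi + ε) : 0 < infoMax μ₀ μ₁ A₀ A₁ w z :=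
    (div_pos hc0 hmax).trans_le (hc ▸ le_infoMax hA₀ hA₁ h01 hz hzb)
  have hMhat0 : 0 < infoMax μ₀ μ₁ A₀ A₁ u v := hpos (by linarith) (by linarith)
  have hM0 : 0 < infoMax μ₀ μ₁ A₀ A₁ μ s2 := hpos (by linarith) (by linarith)
  refine ⟨⟨⟨by linarith, by linarith⟩, by linarith, by linarith⟩, ?_⟩
  rw [totalSize_div_totalSize hA₀ hA₁ hMhat0]
  constructor
  · rw [ENNReal.ofReal_lt_ofReal_iff (by positivity), inv_lt_comm₀ (by positivity) (by positivity),
      inv_div, div_lt_iff₀ hM0, mul_comm]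
    exact hMhat.trans_lt (by gcongr)
  · rw [ENNReal.ofReal_lt_ofReal_iff (by positivity), div_lt_iff₀ hMhat0, mul_comm]
    exact hM.trans_lt (by gcongr)

theorem lemma2p1 (μ₀ μ₁ μlo μhi slo shi ε R : ℝ)
    (hlo : μlo < μ₀) (h01 : μ₀ < μ₁) (hhi : μ₁ < μhi)
    (hslo : 0 < slo) (hshi : slo ≤ shi)
    (hε : 0 < ε) (hεs : ε < slo) (hR : 1 ≤ R) :
    ∃ B : ℝ, 0 < B ∧ ∃ C : ℝ,
      ∀ A₀ A₁ : ℝ, 0 < A₀ → 0 < A₁ → A₀ ≤ R * A₁ → A₁ ≤ R * A₀ →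
      ∀ μ s2 : ℝ, (μ, s2) ∈ paramBox μlo μhi slo shi →
      ∀ (Ω : Type*) [MeasurableSpace Ω] (P : Measure Ω) [IsProbabilityMeasure P]
        (X : ℕ → Ω → ℝ),
        (∀ i, HasLaw (X i) (gaussianReal μ s2.toNNReal) P) → iIndepFun X P →
      ∀ k₀ : ℕ, 1 ≤ k₀ →
        1 - C / k₀ ≤
          P.real (goodEvent X μ₀ μ₁ A₀ A₁ μlo μhi slo shi ε B μ s2 k₀) := by
  have hshi0 : 0 < shi := hslo.trans_le hshi
  obtain ⟨c, hc⟩ : ∃ c, c = 1 / 2 * Real.log (1 + ((μ₁ - μ₀) / 2) ^ 2 / (shi + ε)) := ⟨_, rfl⟩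
  have hc0 : 0 < c := by
    have h1 : 0 < (μ₁ - μ₀) / 2 := by linarith
    have h2 : 0 < ((μ₁ - μ₀) / 2) ^ 2 / (shi + ε) := by positivity
    rw [hc]
    exact mul_pos (by norm_num) (Real.log_pos (by linarith))
  -- The relative Lipschitz constant of M times the constant in δ = 8(1 + shi)s.
  obtain ⟨K, hK⟩ : ∃ K, K = (1 + (μhi - μlo + ε)) / (slo - ε) * R / c * (8 * (1 + shi)) :=
    ⟨_, rfl⟩
  have hK0 : 0 ≤ K := by
    have h1 : 0 < slo - ε := by linarith
    have h2 : 0 < μhi - μlo := by linarith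
    rw [hK]
    positivity
  obtain ⟨N, hN⟩ := eventually_sqrt_inv_mul_log_lt
    (lt_min (by positivity : (0 : ℝ) < 1 / 8) (by positivity : 0 < ε / (8 * (1 + shi))))
  -- The extra 1 in B makes the ratio bounds strict. In C, the 8 comes from the union bound, and N +
  -- 2 makes the claim trivial for k₀ < N + 2; otherwise k ≥ 2, so that log k and s are positive.
  refine ⟨K + 1, by positivity, max (8 : ℝ) ((N : ℝ) + 2), ?_⟩
  intro A₀ A₁ hA₀ hA₁ hR0 hR1 μ s2 hmem Ω _ P _ X hX hind k₀ hk₀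
  have hk₀' : (1 : ℝ) ≤ k₀ := by exact_mod_cast hk₀
  rcases lt_or_ge k₀ (N + 2) with hlt | hge
  · have h1 : (k₀ : ℝ) ≤ max (8 : ℝ) ((N : ℝ) + 2) := le_max_of_le_right (by exact_mod_cast hlt.le)
    have h2 : 1 ≤ max 8 ((N : ℝ) + 2) / k₀ := (one_le_div (by linarith)).2 h1
    exact le_trans (by linarith) measureReal_nonneg
  have hs2 : 0 < s2 := hslo.trans_le hmem.2.1
  have hσ : 0 < √s2 := Real.sqrt_pos.2 hs2
  have hZ : ∀ i, HasLaw (fun ω => (X i ω - μ) / √s2) (gaussianReal 0 1) P :=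
    fun i => hasLaw_standardize hs2 (hX i)
  have hZind : iIndepFun (fun i ω => (X i ω - μ) / √s2) P :=
    hind.comp (fun _ x => (x - μ) / √s2) fun _ => by fun_prop
  obtain ⟨E, hE⟩ : ∃ E : ℕ → Set Ω, E = fun k : ℕ =>
      {ω | k * (4 * √((k : ℝ)⁻¹ * Real.log k)) ≤
        |∑ i ∈ Finset.range k, (X i ω - μ) / √s2|} ∪
      {ω | k * (4 * √((k : ℝ)⁻¹ * Real.log k)) ≤
        |∑ i ∈ Finset.range k, (((X i ω - μ) / √s2) ^ 2 - 1)|} := ⟨_, rfl⟩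
  have hbad : P.real (⋃ j, E (k₀ + j)) ≤ 2 * 4 / k₀ := by
    refine measureReal_iUnion_le_of_inv_sq hk₀ (by norm_num) fun k hk => ?_
    rw [hE]
    exact measureReal_standard_deviation_le hZ hZind (by omega) rfl
      ((hN k (by omega)).le.trans (min_le_left _ _))
  have hsub : (⋃ j, E (k₀ + j))ᶜ ⊆
      goodEvent X μ₀ μ₁ A₀ A₁ μlo μhi slo shi ε (K + 1) μ s2 k₀ := by
    intro ω hω k hk
    have hωk : ω ∉ E k := fun h => hω (Set.mem_iUnion.2 ⟨k - k₀, by rwa [Nat.add_sub_cancel' hk]⟩)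
    rw [hE] at hωk
    simp only [Set.mem_union, Set.mem_ofPred_eq, not_or, not_le] at hωk
    have hk2 : (2 : ℝ) ≤ k := by exact_mod_cast (by omega : 2 ≤ k)
    have hsk := hN k (by omega)
    obtain ⟨s, hs⟩ : ∃ s, s = √((k : ℝ)⁻¹ * Real.log k) := ⟨_, rfl⟩
    have hs0 : 0 < s := by
      have := Real.log_pos (by linarith : (1 : ℝ) < k)
      rw [hs]
      positivity
    rw [← hs] at hωk hsk
    obtain ⟨hs8, hsε⟩ := lt_min_iff.1 hsk
    rw [lt_div_iff₀ (by positivity), mul_comm] at hsε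
    have hclose := sampleMean_sampleVar_close (b := shi) hσ
      ((Real.sq_sqrt hs2.le).trans_le hmem.2.2) (by omega) hs0.le hs8.le hωk.1.le hωk.2.le
    rw [Real.sq_sqrt hs2.le] at hclose
    rw [rho, ← hs]
    refine ratio_bounds_of_close hlo h01 hhi hε hεs hR hA₀ hA₁ hR0 hR1 hmem hc hc0 ?_ hsε
      hclose.1 hclose.2
    rw [← mul_assoc, ← hK]
    gcongr
    linarith
  have hone : 1 ≤ P.real (⋃ j, E (k₀ + j)) + P.real (⋃ j, E (k₀ + j))ᶜ := by
    rw [← probReal_univ (μ := P), ← Set.union_compl_self (⋃ j, E (k₀ + j))]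
    exact measureReal_union_le _ _
  have hmono := measureReal_mono (μ := P) hsub
  have hC : 2 * 4 / (k₀ : ℝ) ≤ max 8 ((N : ℝ) + 2) / k₀ := by
    gcongr
    exact le_trans (by norm_num) (le_max_left _ _)
  linarith
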